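/- Consider a single-parameter environment with finitely many agents $i\in N$ and a downward-closed family $\mathcal F\subseteq 2^{N}$ of feasible sets (every subset of a feasible set is feasible; $\mathcal F\neq\emptyset$). The agents' values $v_i\ge 0$ are independent; $v_i$ has cumulative distribution function $F_i$ and density $f_i$. Let $\phi_i(x)=x-\frac{1-F_i(x)}{f_i(x)}$ be the virtual valuation, considered at positive $x$ with $F_i(x)<1$ (with $\phi_i(x)=-\infty$ where $f_i(x)=0$). Assume that every distribution is - hyper-regular: $\phi_i(x)$ and $\phi_i(x)/x$ are non-decreasing; and - $c$-bounded, for a common constant $c>0$: $\mathbb E[v_i]\le c\cdot\sup_{p\ge 0}p\,(1-F_i(p))$. The mechanism VCG-L (VCG with lazy reserves) works as follows on a bid vector $b$. It first selects a feasible set $P\in\mathcal F$ maximizing $\sum_{i\in P}b_i$ (ties broken arbitrarily), then removes every $i\in P$ with $b_i<r_i$, where $r_i=\phi_i^{-1}(0)$, that is, $r_i=\inf\{x:\phi_i(x)\ge 0\}$. It charges each remaining agent $i$ the larger of $r_i$ and the VCG payment $\max_{S\in\mathcal F}\sum_{j\in S\setminus\{i\}}b_j-\sum_{j\in P\setminus\{i\}}b_j$;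 all other agents pay $0$. Then VCG-L always serves a feasible set, bidding truthfully is a dominant strategy for every agent, and under truthful bidding the expected revenue of VCG-L is at least $1/c$ times the expected welfare of the efficient allocation: $$\mathbb E\Big[\sum_i p_i(v)\Big]\;\ge\;\frac1c\;\mathbb E\Big[\max_{S\in\mathcal F}\sum_{i\in S}v_i\Big],$$ where $p_i(v)$ is the payment of agent $i$ and both expectations are finite. -/

import Mathlib

open MeasureTheory ProbabilityTheory
open scoped ENNReal NNReal

noncomputable section

namespace LazyVCG

/-! ### Value distributions -/

/-- `μ` is the law of a non-negative random value and `f` is a density of it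
(with respect to Lebesgue measure). -/
structure IsValueDensity (μ : Measure ℝ) (f : ℝ → ℝ≥0) : Prop where
  nonneg : μ (Set.Iio 0) = 0
  measurable : Measurable f
  eq_withDensity : μ = volume.withDensity (fun x => (f x : ℝ≥0∞))

/-- The optimal revenue `ρ(X) = sup_{p ≥ 0} p (1 - F(p))` from selling one item to a single
agent with value distribution `μ`. -/
def optimalRevenue (μ : Measure ℝ) : ℝ≥0∞ :=
  ⨆ (p : ℝ) (_ : 0 ≤ p), ENNReal.ofReal (p * (1 - cdf μ p))

/-- `c`-boundedness, `E[X] ≤ c ρ(X)`. Both sides live in `[0, ∞]`, so that an infinite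
expectation is not confused with `0`. -/
def IsCBounded (c : ℝ) (μ : Measure ℝ) : Prop :=
  ∫⁻ x, ENNReal.ofReal x ∂μ ≤ ENNReal.ofReal c * optimalRevenue μ

/-- The hazard rate `h(x) = f(x) / (1 - F(x))`. -/
def hazardRate (μ : Measure ℝ) (f : ℝ → ℝ≥0) (x : ℝ) : ℝ :=
  (f x : ℝ) / (1 - cdf μ x)

/-- The virtual valuation `φ(x) = x - 1 / h(x)`. It is used only on `valueDomain μ f`, where the
hazard rate is well defined and positive. -/
def virtualValue (μ : Measure ℝ) (f : ℝ → ℝ≥0) (x : ℝ) : ℝ :=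
  x - 1 / hazardRate μ f x

/-- The positive values at which the hazard rate is well defined and positive, that is, where
`φ` is defined and finite. -/
def valueDomain (μ : Measure ℝ) (f : ℝ → ℝ≥0) : Set ℝ :=
  {x | 0 < x ∧ cdf μ x < 1 ∧ 0 < f x}

/-- Regularity: the virtual valuation is non-decreasing. A point with `F(x) < 1` and `f(x) = 0`
has `h(x) = 0` and `φ(x) = -∞`; monotonicity of the extended-valued `φ` therefore says that the
domain has no gaps and that `φ` is non-decreasing on it. -/
def IsRegular (μ : Measure ℝ) (f : ℝ → ℝ≥0) : Prop :=
  (valueDomain μ f).OrdConnected ∧ MonotoneOn (virtualValue μ f) (valueDomain μ f)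

/-- Hyper-regularity: regular, and `φ(x) / x` is non-decreasing. -/
def IsHyperRegular (μ : Measure ℝ) (f : ℝ → ℝ≥0) : Prop :=
  IsRegular μ f ∧ MonotoneOn (fun x => virtualValue μ f x / x) (valueDomain μ f)

/-- The reserve price `r = φ⁻¹(0)`: the least value from which on `φ` is non-negative (so that
it also makes sense when `φ` jumps over `0`, is positive on the whole support or has several
zeros). -/
def reservePrice (μ : Measure ℝ) (f : ℝ → ℝ≥0) : ℝ :=
  sInf {x | x ∈ valueDomain μ f ∧ 0 ≤ virtualValue μ f x}

/-! ### Mechanisms -/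

variable {ι : Type*} [Fintype ι] [DecidableEq ι]

/-- A (deterministic) mechanism: a bid vector is mapped to the set of served agents and to the
vector of payments. -/
structure Mechanism (ι : Type*) where
  alloc : (ι → ℝ) → Finset ι
  pay : (ι → ℝ) → ι → ℝ

/-- The served set is always feasible. -/
def Mechanism.IsFeasible (M : Mechanism ι) (𝓕 : Set (Finset ι)) : Prop :=
  ∀ b, M.alloc b ∈ 𝓕

/-- Quasi-linear utility of agent `i` with value `x` when the bids are `b`. -/
def Mechanism.utility (M : Mechanism ι) (i : ι) (x : ℝ) (b : ι → ℝ) : ℝ :=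
  (if i ∈ M.alloc b then x else 0) - M.pay b i

/-- Bidding one's true value is a dominant strategy for every agent. -/
def Mechanism.IsTruthful (M : Mechanism ι) : Prop :=
  ∀ (i : ι) (x : ℝ) (b : ι → ℝ),
    M.utility i x b ≤ M.utility i x (Function.update b i x)

/-- The total payment. -/
def Mechanism.revenue (M : Mechanism ι) (b : ι → ℝ) : ℝ :=
  ∑ i, M.pay b i

/-- The maximum welfare of a feasible set, for values `v`. -/
def maxWelfare (𝓕 : Set (Finset ι)) (v : ι → ℝ) : ℝ :=
  ⨆ S : 𝓕, ∑ i ∈ S.1, v i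

/-- `A` selects, for every bid vector, a feasible set of maximum total bid. -/
def IsEfficientRule (𝓕 : Set (Finset ι)) (A : (ι → ℝ) → Finset ι) : Prop :=
  ∀ b, A b ∈ 𝓕 ∧ ∀ S ∈ 𝓕, ∑ i ∈ S, b i ≤ ∑ i ∈ A b, b i

/-- The VCG (Clarke pivot) payment of agent `i`: the largest total bid that the other agents
could achieve, minus what they achieve in the selected set. -/
def vcgPayment (𝓕 : Set (Finset ι)) (A : (ι → ℝ) → Finset ι) (b : ι → ℝ) (i : ι) : ℝ :=
  (⨆ S : 𝓕, ∑ j ∈ S.1.erase i, b j) - ∑ j ∈ (A b).erase i, b j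

/-- VCG with lazy reserves `r`: run VCG, remove the winners who bid below their reserve, and
charge each remaining winner the larger of the reserve and the VCG payment. -/
def vcgLazy (𝓕 : Set (Finset ι)) (A : (ι → ℝ) → Finset ι) (r : ι → ℝ) : Mechanism ι where
  alloc b := (A b).filter (fun i => r i ≤ b i)
  pay b i := if i ∈ A b ∧ r i ≤ b i then max (r i) (vcgPayment 𝓕 A b i) else 0

end LazyVCG

end

/-! Fix agent `i` and the other bids. In VCG she wins exactly above a threshold `t` independent of
her own bid, up to ties, which have probability zero because the laws have densities. She
contributes `E[v; v > t]` to the welfare and pays `m = max r t` when `v > m`. With `G = 1 - F`, it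
suffices to prove the one-agent inequality `E[v; v > t] ≤ c m G(m)`
(`IsHyperRegular.lintegral_Ioi_le`), integrate over the other bids (`lintegral_welfare_le`) and sum
over agents.

For `t ≤ r` the inequality is `c`-boundedness, since `r` is a monopoly price
(`IsRegular.optimalRevenue_le`). For `t ≥ r` it follows from the case `t = r` because `E[v; v > t] /
(t G(t))` is non-increasing above `r`: hyper-regularity makes `x h(x)` non-decreasing, so `u ↦ G(exp
u)` is log-concave and `G(t u) / G(t)` decreases in `t` for each `u ≥ 1`.

Truthfulness is the usual argument for a bid-independent price. -/

namespace LazyVCG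

/-! ### Survival function: weighted monotonicity from pointwise bounds on the density. -/

section Tail

variable {μ : Measure ℝ} {f : ℝ → ℝ≥0}

/-- The survival function `1 - F`. -/
noncomputable def tail (μ : Measure ℝ) (x : ℝ) : ℝ := μ.real (Set.Ioi x)

lemma tail_nonneg (μ : Measure ℝ) (x : ℝ) : 0 ≤ tail μ x := measureReal_nonneg

lemma IsValueDensity.nullSingletonClass (hf : IsValueDensity μ f) : NullSingletonClass μ := by
  rw [hf.eq_withDensity]; infer_instance

lemma IsValueDensity.tail_eq_integral (hf : IsValueDensity μ f) (x : ℝ) :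
    tail μ x = ∫ s in Set.Ioi x, (f s : ℝ) := by
  rw [integral_eq_lintegral_of_nonneg_ae (Filter.Eventually.of_forall fun _ => NNReal.coe_nonneg _)
    hf.measurable.coe_nnreal_real.aestronglyMeasurable, tail, Measure.real, hf.eq_withDensity,
    withDensity_apply _ measurableSet_Ioi]
  simp

lemma ofReal_tail (μ : Measure ℝ) [IsProbabilityMeasure μ] (x : ℝ) :
    ENNReal.ofReal (tail μ x) = μ (Set.Ioi x) := by
  simp [tail]

lemma tail_antitone (μ : Measure ℝ) [IsProbabilityMeasure μ] : Antitone (tail μ) :=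
  fun _ _ h => measureReal_mono (Set.Ioi_subset_Ioi h)

lemma tail_le_one (μ : Measure ℝ) [IsProbabilityMeasure μ] (x : ℝ) : tail μ x ≤ 1 :=
  measureReal_le_one

lemma one_sub_cdf (μ : Measure ℝ) [IsProbabilityMeasure μ] (x : ℝ) : 1 - cdf μ x = tail μ x := by
  rw [cdf_eq_real, tail, ← Set.compl_Iic, probReal_compl_eq_one_sub measurableSet_Iic]

lemma mem_valueDomain [IsProbabilityMeasure μ] {x : ℝ} :
    x ∈ valueDomain μ f ↔ 0 < x ∧ 0 < tail μ x ∧ 0 < f x := by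
  rw [← one_sub_cdf, sub_pos]; rfl

lemma virtualValue_eq [IsProbabilityMeasure μ] {x : ℝ} :
    virtualValue μ f x = x - tail μ x / f x := by
  simp [virtualValue, hazardRate, one_sub_cdf]

variable [IsProbabilityMeasure μ]

lemma IsValueDensity.integrable_density (hf : IsValueDensity μ f) : Integrable (fun x => (f x : ℝ)) := by
  refine ⟨hf.measurable.coe_nnreal_real.aestronglyMeasurable, ?_⟩
  have h := measure_univ (μ := μ)
  rw [hf.eq_withDensity, withDensity_apply _ MeasurableSet.univ, Measure.restrict_univ] at h
  simp only [HasFiniteIntegral, NNReal.enorm_eq]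
  simp [h]

lemma IsValueDensity.tail_zero (hf : IsValueDensity μ f) : tail μ 0 = 1 := by
  have := hf.nullSingletonClass
  have h : μ (Set.Iic 0) = 0 := by
    rw [← measure_congr Iio_ae_eq_Iic, hf.nonneg]
  rw [← one_sub_cdf, cdf_eq_real]; simp [Measure.real, h]

lemma IsValueDensity.tail_sub (hf : IsValueDensity μ f) (x y : ℝ) : tail μ y = tail μ x - ∫ s in x..y, (f s : ℝ) := by
  rw [hf.tail_eq_integral, hf.tail_eq_integral,
    ← intervalIntegral.integral_Ioi_sub_Ioi' hf.integrable_density.integrableOn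
      hf.integrable_density.integrableOn]
  ring

lemma IsValueDensity.continuous_tail (hf : IsValueDensity μ f) : Continuous (tail μ) := by
  have h : tail μ = fun y => tail μ 0 - ∫ s in (0:ℝ)..y, (f s : ℝ) := funext fun y => hf.tail_sub 0 y
  rw [h]
  exact continuous_const.sub (intervalIntegral.continuous_primitive
    (fun _ _ => hf.integrable_density.intervalIntegrable) 0)

lemma IsValueDensity.absolutelyContinuous_tail (hf : IsValueDensity μ f) (x y : ℝ) :
    AbsolutelyContinuousOnInterval (tail μ) x y := by
  have h : tail μ = fun z => -(∫ s in x..z, (f s : ℝ)) + tail μ x :=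
    funext fun z => by rw [hf.tail_sub x z]; ring
  rw [h]
  exact ((hf.integrable_density.intervalIntegrable).absolutelyContinuousOnInterval_intervalIntegral
    (c := x) (by simp)).neg.add
      (contDiffOn_const (n := 1)).absolutelyContinuousOnInterval

lemma IsValueDensity.ae_hasDerivAt_tail (hf : IsValueDensity μ f) : ∀ᵐ s, HasDerivAt (tail μ) (-(f s : ℝ)) s := by
  have h : tail μ = fun z => tail μ 0 - ∫ s in (0:ℝ)..z, (f s : ℝ) :=
    funext fun z => hf.tail_sub 0 z
  have h2 := _root_.LocallyIntegrable.ae_hasDerivAt_integral hf.integrable_density.locallyIntegrable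
  filter_upwards [h2] with s hs
  rw [h]
  simpa using (hs 0).const_sub (tail μ 0)

/-- The density is merely measurable, so `G` is differentiable only almost everywhere; absolute
continuity still gives the fundamental theorem for `w G`. -/
lemma IsValueDensity.mul_tail_sub_mul_tail (hf : IsValueDensity μ f) {w : ℝ → ℝ} {x y : ℝ}
    (hw : ContDiffOn ℝ 1 w (Set.uIcc x y)) :
    ∫ s in x..y, (deriv w s * tail μ s - w s * f s) = w y * tail μ y - w x * tail μ x := by
  rw [← hw.absolutelyContinuousOnInterval.integral_deriv_mul_eq_sub
    (hf.absolutelyContinuous_tail x y)]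
  refine intervalIntegral.integral_congr_ae ?_
  filter_upwards [hf.ae_hasDerivAt_tail] with s hs _
  rw [hs.deriv]; ring

/-- If `(w G)' ≤ 0` on `(x, y)`, then `w(y) G(y) ≤ w(x) G(x)`. -/
lemma IsValueDensity.mul_tail_le (hf : IsValueDensity μ f) {w : ℝ → ℝ} {x y : ℝ} (hxy : x ≤ y)
    (hw : ContDiffOn ℝ 1 w (Set.Icc x y))
    (h : ∀ s ∈ Set.Ioo x y, deriv w s * tail μ s ≤ w s * f s) :
    w y * tail μ y ≤ w x * tail μ x := by
  rw [← sub_nonpos, ← hf.mul_tail_sub_mul_tail (by rwa [Set.uIcc_of_le hxy]),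
    intervalIntegral.integral_of_le hxy, integral_Ioc_eq_integral_Ioo]
  exact setIntegral_nonpos measurableSet_Ioo fun s hs => sub_nonpos.2 (h s hs)

/-- If `(w G)' ≥ 0` on `(x, y)`, then `w(x) G(x) ≤ w(y) G(y)`. -/
lemma IsValueDensity.le_mul_tail (hf : IsValueDensity μ f) {w : ℝ → ℝ} {x y : ℝ} (hxy : x ≤ y)
    (hw : ContDiffOn ℝ 1 w (Set.Icc x y))
    (h : ∀ s ∈ Set.Ioo x y, w s * f s ≤ deriv w s * tail μ s) :
    w x * tail μ x ≤ w y * tail μ y := by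
  rw [← sub_nonneg, ← hf.mul_tail_sub_mul_tail (by rwa [Set.uIcc_of_le hxy]),
    intervalIntegral.integral_of_le hxy, integral_Ioc_eq_integral_Ioo]
  exact setIntegral_nonneg measurableSet_Ioo fun s hs => sub_nonneg.2 (h s hs)

lemma IsValueDensity.rpow_mul_tail_le (hf : IsValueDensity μ f) {γ x y : ℝ} (hx : 0 < x) (hxy : x ≤ y)
    (h : ∀ s ∈ Set.Ioo x y, γ * tail μ s ≤ s * f s) :
    y ^ γ * tail μ y ≤ x ^ γ * tail μ x := by
  refine hf.mul_tail_le (w := fun s => s ^ γ) hxy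
    (fun s hs => (Real.contDiffAt_rpow_const_of_ne (hx.trans_le hs.1).ne').contDiffWithinAt) ?_
  intro s hs
  have hs0 : 0 < s := hx.trans hs.1
  rw [Real.deriv_rpow_const, Real.rpow_sub_one hs0.ne']
  have := mul_le_mul_of_nonneg_left (h s hs) (div_nonneg (Real.rpow_nonneg hs0.le γ) hs0.le)
  calc _ = s ^ γ / s * (γ * tail μ s) := by ring
    _ ≤ _ := this
    _ = _ := by field_simp

lemma IsValueDensity.le_rpow_mul_tail (hf : IsValueDensity μ f) {γ x y : ℝ} (hx : 0 < x) (hxy : x ≤ y)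
    (h : ∀ s ∈ Set.Ioo x y, s * f s ≤ γ * tail μ s) :
    x ^ γ * tail μ x ≤ y ^ γ * tail μ y := by
  refine hf.le_mul_tail (w := fun s => s ^ γ) hxy
    (fun s hs => (Real.contDiffAt_rpow_const_of_ne (hx.trans_le hs.1).ne').contDiffWithinAt) ?_
  intro s hs
  have hs0 : 0 < s := hx.trans hs.1
  rw [Real.deriv_rpow_const, Real.rpow_sub_one hs0.ne']
  have := mul_le_mul_of_nonneg_left (h s hs) (div_nonneg (Real.rpow_nonneg hs0.le γ) hs0.le)
  calc _ = s ^ γ / s * (s * f s) := by field_simp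
    _ ≤ _ := this
    _ = _ := by ring

lemma IsValueDensity.id_mul_tail_le (hf : IsValueDensity μ f) {x y K : ℝ} (hxy : x ≤ y)
    (h : ∀ s ∈ Set.Ioo x y, tail μ s ≤ (s + K) * f s) :
    (y + K) * tail μ y ≤ (x + K) * tail μ x := by
  refine hf.mul_tail_le (w := fun s => s + K) hxy (by fun_prop) fun s hs => ?_
  simpa using h s hs

lemma IsValueDensity.le_id_mul_tail (hf : IsValueDensity μ f) {x y : ℝ} (hxy : x ≤ y)
    (h : ∀ s ∈ Set.Ioo x y, s * f s ≤ tail μ s) :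
    x * tail μ x ≤ y * tail μ y := by
  refine hf.le_mul_tail (w := fun s => s) hxy (by fun_prop) fun s hs => ?_
  simpa using h s hs

end Tail

/-! ### One agent: reserve price, revenue curve and truncated mean. -/

section SingleAgent

variable {μ : Measure ℝ} [IsProbabilityMeasure μ] {f : ℝ → ℝ≥0}

lemma tendsto_tail_atTop (μ : Measure ℝ) [IsProbabilityMeasure μ] :
    Filter.Tendsto (tail μ) Filter.atTop (nhds 0) := by
  have h := (tendsto_cdf_atTop μ).const_sub 1
  rw [sub_self] at h
  exact h.congr fun x => one_sub_cdf μ x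

lemma IsValueDensity.exists_mem_valueDomain_gt (hf : IsValueDensity μ f) {t : ℝ} (ht : 0 ≤ t)
    (h : 0 < tail μ t) : ∃ b ∈ valueDomain μ f, t < b := by
  by_contra! hno
  obtain ⟨y, hty, hy⟩ : ∃ y ≥ t, tail μ y ≤ tail μ t / 2 :=
    ((tendsto_tail_atTop μ).eventually_le_const (half_pos h)).and (Filter.eventually_ge_atTop t)
      |>.exists.imp fun _ h => ⟨h.2, h.1⟩
  -- At `z` the tail is exactly half of `tail μ t`, so it is positive on `(t, z)`. With no domain
  -- point beyond `t`, the density vanishes there and the tail could not have dropped.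
  obtain ⟨z, hz, hz'⟩ := intermediate_value_Icc' hty hf.continuous_tail.continuousOn
    ⟨hy, (half_lt_self h).le⟩
  have := hf.le_mul_tail (w := fun _ => 1) hz.1 contDiffOn_const fun s hs => by
    have hs0 : f s = 0 := by
      by_contra hne
      refine (hno s (mem_valueDomain.2 ⟨ht.trans_lt hs.1, ?_, pos_iff_ne_zero.2 hne⟩)).not_gt hs.1
      exact (half_pos h).trans_le (hz' ▸ tail_antitone μ hs.2.le)
    simp [hs0]
  simp only [one_mul] at this
  linarith

lemma IsRegular.mem_valueDomain_of_le (hf : IsValueDensity μ f) (hreg : IsRegular μ f) {a t : ℝ}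
    (ha : a ∈ valueDomain μ f) (hat : a ≤ t) (ht : 0 < tail μ t) : t ∈ valueDomain μ f := by
  obtain ⟨b, hb, htb⟩ := hf.exists_mem_valueDomain_gt ((mem_valueDomain.1 ha).1.le.trans hat) ht
  exact hreg.1.out ha hb ⟨hat, htb.le⟩

lemma virtualValue_nonneg_iff {x : ℝ} (hx : x ∈ valueDomain μ f) :
    0 ≤ virtualValue μ f x ↔ tail μ x ≤ x * f x := by
  have h : (0:ℝ) < f x := (mem_valueDomain.1 hx).2.2
  rw [virtualValue_eq, sub_nonneg, div_le_iff₀ h]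

/-- Hyper-regularity says that `x h(x)` is non-decreasing. -/
lemma IsHyperRegular.mul_hazard_mono (hreg : IsHyperRegular μ f) :
    MonotoneOn (fun x => x * f x / tail μ x) (valueDomain μ f) := by
  intro x hx y hy hxy
  have h := hreg.2 hx hy hxy
  obtain ⟨x0, xG, xf⟩ := mem_valueDomain.1 hx
  obtain ⟨y0, yG, yf⟩ := mem_valueDomain.1 hy
  rw [← NNReal.coe_pos] at xf yf
  simp only [virtualValue_eq, sub_div, div_self x0.ne', div_self y0.ne', sub_le_sub_iff_left,
    div_div] at h
  have h' := inv_anti₀ (by positivity) h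
  simp only [inv_div] at h'
  simpa only [mul_comm] using h'

/-- The set of values with non-negative virtual value. -/
def nonnegVirtual (μ : Measure ℝ) (f : ℝ → ℝ≥0) : Set ℝ :=
  {x | x ∈ valueDomain μ f ∧ 0 ≤ virtualValue μ f x}

lemma reservePrice_nonneg : 0 ≤ reservePrice μ f :=
  Real.sInf_nonneg fun _ hx => (mem_valueDomain.1 hx.1).1.le

lemma reservePrice_le {x : ℝ} (hx : x ∈ nonnegVirtual μ f) : reservePrice μ f ≤ x :=
  csInf_le ⟨0, fun _ hx => (mem_valueDomain.1 hx.1).1.le⟩ hx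

lemma IsRegular.mem_nonnegVirtual (hf : IsValueDensity μ f) (hreg : IsRegular μ f)
    (hne : (nonnegVirtual μ f).Nonempty) {x : ℝ} (hx : reservePrice μ f < x) (hG : 0 < tail μ x) :
    x ∈ nonnegVirtual μ f := by
  obtain ⟨z, hz, hzx⟩ := exists_lt_of_csInf_lt hne hx
  have hD := hreg.mem_valueDomain_of_le hf hz.1 hzx.le hG
  exact ⟨hD, hz.2.trans (hreg.2 hz.1 hD hzx.le)⟩

/-- Above the reserve price the revenue curve is non-increasing. -/
lemma IsRegular.mul_tail_le_reserve (hf : IsValueDensity μ f) (hreg : IsRegular μ f)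
    (hne : (nonnegVirtual μ f).Nonempty) {p : ℝ} (hp : reservePrice μ f ≤ p) :
    p * tail μ p ≤ reservePrice μ f * tail μ (reservePrice μ f) := by
  have h := hf.id_mul_tail_le (K := 0) hp fun s hs => by
    rcases (tail_nonneg μ s).eq_or_lt with h0 | h0
    · rw [← h0, add_zero]
      exact mul_nonneg (reservePrice_nonneg.trans hs.1.le) (NNReal.coe_nonneg _)
    · have hZ := hreg.mem_nonnegVirtual hf hne hs.1 h0
      simpa using (virtualValue_nonneg_iff hZ.1).1 hZ.2
  simpa using h

lemma IsRegular.reserve_mul_tail_pos (hf : IsValueDensity μ f) (hreg : IsRegular μ f)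
    (hne : (nonnegVirtual μ f).Nonempty) :
    0 < reservePrice μ f * tail μ (reservePrice μ f) := by
  obtain ⟨z, hz⟩ := hne
  have hz' := mem_valueDomain.1 hz.1
  exact (mul_pos hz'.1 hz'.2.1).trans_le (hreg.mul_tail_le_reserve hf ⟨z, hz⟩ (reservePrice_le hz))

lemma IsRegular.reserve_pos (hf : IsValueDensity μ f) (hreg : IsRegular μ f)
    (hne : (nonnegVirtual μ f).Nonempty) : 0 < reservePrice μ f :=
  pos_of_mul_pos_left (hreg.reserve_mul_tail_pos hf hne) (tail_nonneg _ _)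

/-- Below the reserve price the revenue curve is non-decreasing. -/
lemma IsRegular.mul_tail_le_reserve' (hf : IsValueDensity μ f)
    (hne : (nonnegVirtual μ f).Nonempty) {p : ℝ} (hp0 : 0 ≤ p) (hp : p ≤ reservePrice μ f) :
    p * tail μ p ≤ reservePrice μ f * tail μ (reservePrice μ f) := by
  refine hf.le_id_mul_tail hp fun s hs => ?_
  obtain ⟨z, hz⟩ := hne
  by_contra! hlt
  have hG : 0 < tail μ s := (mem_valueDomain.1 hz.1).2.1.trans_le
    (tail_antitone μ (hs.2.le.trans (reservePrice_le hz)))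
  have hfs : 0 < f s := by
    rw [pos_iff_ne_zero]
    intro h0
    simp [h0] at hlt
    linarith
  have hD : s ∈ valueDomain μ f := mem_valueDomain.2 ⟨hp0.trans_lt hs.1, hG, hfs⟩
  exact (reservePrice_le ⟨hD, (virtualValue_nonneg_iff hD).2 hlt.le⟩).not_gt hs.2

/-- The reserve price is a monopoly price. -/
lemma IsRegular.optimalRevenue_le (hf : IsValueDensity μ f) (hreg : IsRegular μ f)
    (hne : (nonnegVirtual μ f).Nonempty) :
    optimalRevenue μ ≤ ENNReal.ofReal (reservePrice μ f * tail μ (reservePrice μ f)) := by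
  refine iSup₂_le fun p hp => ENNReal.ofReal_le_ofReal ?_
  rw [one_sub_cdf]
  rcases le_total p (reservePrice μ f) with h | h
  · exact IsRegular.mul_tail_le_reserve' hf hne hp h
  · exact hreg.mul_tail_le_reserve hf hne h

/-- Log-concavity of `u ↦ G(exp u)` above the reserve price. -/
lemma IsHyperRegular.tail_mul_tail_le (hf : IsValueDensity μ f) (hreg : IsHyperRegular μ f)
    (hne : (nonnegVirtual μ f).Nonempty) {a b c d : ℝ} (ha : reservePrice μ f ≤ a) (hab : a < b)
    (hbc : b ≤ c) (hcd : c < d) (h : a * d = b * c) :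
    tail μ a * tail μ d ≤ tail μ b * tail μ c := by
  rcases (tail_nonneg μ d).eq_or_lt with h0 | h0
  · rw [← h0, mul_zero]; exact mul_nonneg (tail_nonneg _ _) (tail_nonneg _ _)
  have hD : ∀ s, a < s → s ≤ d → s ∈ valueDomain μ f := fun s h1 h2 =>
    (hreg.1.mem_nonnegVirtual hf hne (ha.trans_lt h1) (h0.trans_le (tail_antitone μ h2))).1
  have ha0 : 0 < a := (hreg.1.reserve_pos hf hne).trans_le ha
  have hb0 := ha0.trans hab
  have hc0 := hb0.trans_le hbc
  have hd0 := hc0.trans hcd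
  have hbD := hD b hab (hbc.trans hcd.le)
  -- `-γ` is the slope of `log G(exp u)` at `log b`. Since `x h(x)` is non-decreasing, `s ^ γ * G s`
  -- rises up to `b` and falls after it; the powers cancel because `a d = b c`.
  set γ : ℝ := b * f b / tail μ b
  have h1 : a ^ γ * tail μ a ≤ b ^ γ * tail μ b := by
    refine hf.le_rpow_mul_tail ha0 hab.le fun s hs => ?_
    have hsD := hD s hs.1 (hs.2.le.trans (hbc.trans hcd.le))
    exact (div_le_iff₀ (mem_valueDomain.1 hsD).2.1).1 (hreg.mul_hazard_mono hsD hbD hs.2.le)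
  have h2 : d ^ γ * tail μ d ≤ c ^ γ * tail μ c := by
    refine hf.rpow_mul_tail_le hc0 hcd.le fun s hs => ?_
    have hsD := hD s (hab.trans_le (hbc.trans hs.1.le)) hs.2.le
    exact (le_div_iff₀ (mem_valueDomain.1 hsD).2.1).1
      (hreg.mul_hazard_mono hbD hsD (hbc.trans hs.1.le))
  have h3 := mul_le_mul h1 h2 (mul_nonneg (Real.rpow_nonneg hd0.le _) (tail_nonneg _ _))
    (mul_nonneg (Real.rpow_nonneg hb0.le _) (tail_nonneg _ _))
  have e1 : a ^ γ * d ^ γ = b ^ γ * c ^ γ := by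
    rw [← Real.mul_rpow ha0.le hd0.le, ← Real.mul_rpow hb0.le hc0.le, h]
  refine le_of_mul_le_mul_left ?_ (mul_pos (Real.rpow_pos_of_pos hb0 γ) (Real.rpow_pos_of_pos hc0 γ))
  calc b ^ γ * c ^ γ * (tail μ a * tail μ d) = a ^ γ * tail μ a * (d ^ γ * tail μ d) := by
        rw [← e1]; ring
    _ ≤ _ := h3
    _ = _ := by ring

/-- Log-concavity for the outer points `r`, `t u` and the inner points `t`, `r u`, which have the
same product. -/
lemma IsHyperRegular.tail_ratio_antitone (hf : IsValueDensity μ f) (hreg : IsHyperRegular μ f)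
    (hne : (nonnegVirtual μ f).Nonempty) {r t u : ℝ} (hr : reservePrice μ f ≤ r) (hrt : r ≤ t)
    (hu : 1 ≤ u) : tail μ (t * u) * tail μ r ≤ tail μ t * tail μ (r * u) := by
  rcases hrt.eq_or_lt with rfl | hrt
  · rw [mul_comm]
  rcases hu.eq_or_lt with rfl | hu
  · simp
  have hr0 : 0 < r := (hreg.1.reserve_pos hf hne).trans_le hr
  have h1 : r < r * u := by nlinarith
  have h2 : t < t * u := by nlinarith
  have h3 : r * u < t * u := by nlinarith
  rcases le_total t (r * u) with h | h
  · rw [mul_comm]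
    exact hreg.tail_mul_tail_le hf hne hr hrt h h3 (by ring)
  · rw [mul_comm, mul_comm (tail μ t)]
    exact hreg.tail_mul_tail_le hf hne hr h1 h h2 (by ring)

/-- Layer-cake formula for `x / t` on `x > t`; rescaling by `t` makes different truncation points
comparable level by level. -/
lemma lintegral_Ioi_eq {t : ℝ} (ht : 0 < t) :
    ∫⁻ x in Set.Ioi t, ENNReal.ofReal x ∂μ =
      ENNReal.ofReal t * ∫⁻ u in Set.Ioi (0:ℝ), ENNReal.ofReal (tail μ (t * max 1 u)) := by
  have h1 : ∀ x, ENNReal.ofReal x = ENNReal.ofReal t * ENNReal.ofReal (x / t) := fun x => by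
    rw [← ENNReal.ofReal_mul ht.le, mul_div_cancel₀ _ ht.ne']
  rw [lintegral_congr h1, lintegral_const_mul _ (by fun_prop)]
  congr 1
  rw [lintegral_eq_lintegral_meas_lt]
  · refine setLIntegral_congr_fun measurableSet_Ioi fun u _ => ?_
    rw [ofReal_tail, Measure.restrict_apply (measurableSet_lt measurable_const (by fun_prop))]
    congr 1
    ext x
    simp only [Set.mem_inter_iff, Set.mem_ofPred_eq, Set.mem_Ioi, lt_div_iff₀ ht,
      mul_max_of_nonneg _ _ ht.le, mul_one, max_lt_iff, mul_comm t u, and_comm]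
  · filter_upwards [ae_restrict_mem measurableSet_Ioi] with x hx
    exact div_nonneg (ht.le.trans (le_of_lt hx)) ht.le
  · fun_prop

lemma IsHyperRegular.conditional_mean_antitone (hf : IsValueDensity μ f)
    (hreg : IsHyperRegular μ f) (hne : (nonnegVirtual μ f).Nonempty) {r t : ℝ}
    (hr : reservePrice μ f ≤ r) (hrt : r ≤ t) :
    (∫⁻ x in Set.Ioi t, ENNReal.ofReal x ∂μ) * ENNReal.ofReal (r * tail μ r) ≤
      ENNReal.ofReal (t * tail μ t) * ∫⁻ x in Set.Ioi r, ENNReal.ofReal x ∂μ := by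
  have hr0 : 0 < r := (hreg.1.reserve_pos hf hne).trans_le hr
  have ht0 := hr0.trans_le hrt
  have hm : ∀ s, Measurable fun u => ENNReal.ofReal (tail μ (s * max 1 u)) := fun s =>
    (hf.continuous_tail.comp (by fun_prop : Continuous fun u : ℝ => s * max 1 u)).measurable.ennreal_ofReal
  rw [lintegral_Ioi_eq ht0, lintegral_Ioi_eq hr0, ENNReal.ofReal_mul hr0.le,
    ENNReal.ofReal_mul ht0.le]
  have key : (∫⁻ u in Set.Ioi (0:ℝ), ENNReal.ofReal (tail μ (t * max 1 u))) *
      ENNReal.ofReal (tail μ r) ≤ ENNReal.ofReal (tail μ t) *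
      ∫⁻ u in Set.Ioi (0:ℝ), ENNReal.ofReal (tail μ (r * max 1 u)) := by
    rw [← lintegral_mul_const _ (hm t), ← lintegral_const_mul _ (hm r)]
    refine lintegral_mono fun u => ?_
    rw [← ENNReal.ofReal_mul (tail_nonneg _ _), ← ENNReal.ofReal_mul (tail_nonneg _ _)]
    exact ENNReal.ofReal_le_ofReal
      (hreg.tail_ratio_antitone hf hne hr hrt (le_max_left 1 u))
  calc _ = ENNReal.ofReal t * ENNReal.ofReal r * ((∫⁻ u in Set.Ioi (0:ℝ),
        ENNReal.ofReal (tail μ (t * max 1 u))) * ENNReal.ofReal (tail μ r)) := by ring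
    _ ≤ _ := mul_le_mul' le_rfl key
    _ = _ := by ring

lemma IsCBounded.lintegral_le {c : ℝ} (hf : IsValueDensity μ f) (hreg : IsRegular μ f)
    (hne : (nonnegVirtual μ f).Nonempty) (hb : IsCBounded c μ) :
    ∫⁻ x, ENNReal.ofReal x ∂μ ≤
      ENNReal.ofReal c * ENNReal.ofReal (reservePrice μ f * tail μ (reservePrice μ f)) :=
  hb.trans (by gcongr; exact hreg.optimalRevenue_le hf hne)

lemma IsHyperRegular.lintegral_Ioi_le {c : ℝ} (hf : IsValueDensity μ f)
    (hreg : IsHyperRegular μ f) (hne : (nonnegVirtual μ f).Nonempty) (hb : IsCBounded c μ) (t : ℝ) :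
    ∫⁻ x in Set.Ioi t, ENNReal.ofReal x ∂μ ≤ ENNReal.ofReal c *
      ENNReal.ofReal (max (reservePrice μ f) t) * μ (Set.Ioi (max (reservePrice μ f) t)) := by
  set r := reservePrice μ f with hr
  have hE : ∀ s, ∫⁻ x in Set.Ioi s, ENNReal.ofReal x ∂μ ≤
      ENNReal.ofReal c * ENNReal.ofReal (r * tail μ r) := fun s =>
    (setLIntegral_le_lintegral _ _).trans (hb.lintegral_le hf hreg.1 hne)
  have hm : 0 ≤ max r t := le_max_of_le_left reservePrice_nonneg
  rw [← ofReal_tail, mul_assoc, ← ENNReal.ofReal_mul hm]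
  rcases le_total t r with h | h
  · rw [max_eq_left h]; exact hE t
  · rw [max_eq_right h]
    -- Positive and finite, so it can be cancelled after bounding the mean above `r` by `c r G(r)`.
    have hpos : ENNReal.ofReal (r * tail μ r) ≠ 0 := by
      simpa using hreg.1.reserve_mul_tail_pos hf hne
    refine (ENNReal.mul_le_mul_iff_left hpos ENNReal.ofReal_ne_top).1 ?_
    calc _ ≤ _ := hreg.conditional_mean_antitone hf hne le_rfl h
      _ ≤ ENNReal.ofReal (t * tail μ t) * (ENNReal.ofReal c * ENNReal.ofReal (r * tail μ r)) := by
        gcongr; exact hE r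
      _ = _ := by ring

/-- A regular distribution has bounded revenue curve. -/
lemma IsRegular.optimalRevenue_lt_top (hf : IsValueDensity μ f) (hreg : IsRegular μ f) :
    optimalRevenue μ < ∞ := by
  obtain ⟨x₀, hx₀, -⟩ := hf.exists_mem_valueDomain_gt le_rfl (by rw [hf.tail_zero]; exact one_pos)
  have hx := mem_valueDomain.1 hx₀
  -- Beyond `x₀` regularity gives `φ ≥ -K`, that is `G ≤ (s + K) f`, so `(s + K) G(s)` is
  -- non-increasing. The maximum with `0` gives `p G(p) ≤ (p + K) G(p)`.
  set K := max 0 (-virtualValue μ f x₀)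
  refine (iSup₂_le fun p hp => ENNReal.ofReal_le_ofReal (q := x₀ + K) ?_).trans_lt
    ENNReal.ofReal_lt_top
  have hK : 0 ≤ K := le_max_left _ _
  rw [one_sub_cdf]
  rcases le_total p x₀ with h | h
  · nlinarith [tail_le_one μ p, tail_nonneg μ p]
  have h1 : (p + K) * tail μ p ≤ (x₀ + K) * tail μ x₀ := by
    refine hf.id_mul_tail_le h fun s hs => ?_
    rcases (tail_nonneg μ s).eq_or_lt with h0 | h0
    · rw [← h0]
      have := hx.1.trans hs.1
      positivity
    · have hsD := hreg.mem_valueDomain_of_le hf hx₀ hs.1.le h0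
      have hv := hreg.2 hx₀ hsD hs.1.le
      have hfs : (0:ℝ) < f s := (mem_valueDomain.1 hsD).2.2
      rw [virtualValue_eq (x := s)] at hv
      rw [← div_le_iff₀ hfs]
      have : -virtualValue μ f x₀ ≤ K := le_max_right _ _
      linarith
  nlinarith [tail_le_one μ x₀, tail_nonneg μ p]

lemma tendsto_mul_tail (h : ∫⁻ x, ENNReal.ofReal x ∂μ ≠ ∞) :
    Filter.Tendsto (fun y => ENNReal.ofReal (y * tail μ y)) Filter.atTop (nhds 0) := by
  have h0 : Filter.Tendsto (fun y => μ (Set.Ioi y)) Filter.atTop (nhds 0) := by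
    simp_rw [← ofReal_tail]
    simpa using ENNReal.tendsto_ofReal (tendsto_tail_atTop μ)
  have h1 := tendsto_setLIntegral_zero h h0
  refine tendsto_of_tendsto_of_tendsto_of_le_of_le' tendsto_const_nhds h1
    (Filter.Eventually.of_forall fun _ => zero_le) ?_
  filter_upwards [Filter.eventually_ge_atTop 0] with y hy
  rw [ENNReal.ofReal_mul hy, ofReal_tail, ← setLIntegral_const]
  exact setLIntegral_mono (by fun_prop) fun x hx => ENNReal.ofReal_le_ofReal (le_of_lt hx)

/-- This excludes the default value `0` of `sInf ∅` as reserve price. If `φ < 0` throughout the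
domain, `y G(y)` never decreases beyond a domain point and stays away from `0`, whereas a finite
mean forces it to tend to `0`. -/
lemma IsRegular.nonnegVirtual_nonempty {c : ℝ} (hf : IsValueDensity μ f) (hreg : IsRegular μ f)
    (hb : IsCBounded c μ) : (nonnegVirtual μ f).Nonempty := by
  by_contra hne
  have hE : ∫⁻ x, ENNReal.ofReal x ∂μ ≠ ∞ :=
    (hb.trans_lt (ENNReal.mul_lt_top ENNReal.ofReal_lt_top (hreg.optimalRevenue_lt_top hf))).ne
  obtain ⟨x₀, hx₀, -⟩ := hf.exists_mem_valueDomain_gt le_rfl (by rw [hf.tail_zero]; exact one_pos)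
  have hx := mem_valueDomain.1 hx₀
  have hR : ∀ y, x₀ ≤ y → (∀ s ∈ Set.Ioo x₀ y, 0 < tail μ s) → x₀ * tail μ x₀ ≤ y * tail μ y := by
    intro y hy hpos
    refine hf.le_id_mul_tail hy fun s hs => ?_
    have hsD := hreg.mem_valueDomain_of_le hf hx₀ hs.1.le (hpos s hs)
    by_contra! hlt
    exact hne ⟨s, hsD, (virtualValue_nonneg_iff hsD).2 hlt.le⟩
  have hG : ∀ y, x₀ ≤ y → 0 < tail μ y := by
    by_contra! hcon
    obtain ⟨y, hy, hy0⟩ := hcon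
    -- Up to the first zero of the tail the revenue curve is non-decreasing from a positive value,
    -- so that zero cannot exist.
    set S := {y | x₀ ≤ y ∧ tail μ y ≤ 0}
    have hbd : BddBelow S := ⟨x₀, fun _ h => h.1⟩
    have hcl : IsClosed S := isClosed_Ici.inter (isClosed_le hf.continuous_tail continuous_const)
    have hmem : sInf S ∈ S := hcl.csInf_mem ⟨y, hy, hy0⟩ hbd
    have := hR _ hmem.1 fun s hs => by
      by_contra! h
      exact (csInf_le hbd ⟨hs.1.le, h⟩).not_gt hs.2
    nlinarith [mul_pos hx.1 hx.2.1, hmem.1, hmem.2, hx.1]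
  have hlt := (tendsto_mul_tail hE).eventually_lt_const
    (ENNReal.ofReal_pos.2 (mul_pos hx.1 hx.2.1))
  obtain ⟨y, hy, hxy⟩ := (hlt.and (Filter.eventually_ge_atTop x₀)).exists
  exact hy.not_ge (ENNReal.ofReal_le_ofReal (hR y hxy fun s hs => hG s hs.1.le))

lemma IsCBounded.integrable_id {c : ℝ} (hf : IsValueDensity μ f) (hreg : IsRegular μ f)
    (hb : IsCBounded c μ) : Integrable id μ := by
  refine ⟨measurable_id.aestronglyMeasurable, ?_⟩
  have h0 : ∀ᵐ x ∂μ, 0 ≤ x := by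
    rw [ae_iff]; simpa [Set.Iio] using hf.nonneg
  have : ∫⁻ x, ‖id x‖ₑ ∂μ = ∫⁻ x, ENNReal.ofReal x ∂μ :=
    lintegral_congr_ae (h0.mono fun x hx => by simp [Real.enorm_of_nonneg hx])
  rw [HasFiniteIntegral, this]
  exact hb.trans_lt (ENNReal.mul_lt_top ENNReal.ofReal_lt_top (hreg.optimalRevenue_lt_top hf))

end SingleAgent

/-! ### VCG thresholds, feasibility and truthfulness. -/

section Threshold

variable {ι : Type*} {𝓕 : Set (Finset ι)} {A : (ι → ℝ) → Finset ι}

lemma IsEfficientRule.maxWelfare_eq [Fintype ι] (hA : IsEfficientRule 𝓕 A) (v : ι → ℝ) :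
    maxWelfare 𝓕 v = ∑ i ∈ A v, v i := by
  have : Nonempty 𝓕 := ⟨⟨A v, (hA v).1⟩⟩
  exact le_antisymm (ciSup_le fun S => (hA v).2 S.1 S.2)
    (le_ciSup (f := fun S : 𝓕 => ∑ i ∈ S.1, v i) (Set.finite_range _).bddAbove ⟨A v, (hA v).1⟩)

variable [DecidableEq ι]

lemma sum_erase_update (i : ι) (b : ι → ℝ) (x : ℝ) (S : Finset ι) :
    ∑ j ∈ S.erase i, Function.update b i x j = ∑ j ∈ S.erase i, b j :=
  Finset.sum_congr rfl fun _ hj => Function.update_of_ne (Finset.ne_of_mem_erase hj) _ _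

/-- The least bid with which agent `i` wins in VCG. It does not depend on `b i`. -/
noncomputable def threshold (𝓕 : Set (Finset ι)) (i : ι) (b : ι → ℝ) : ℝ :=
  (⨆ S : 𝓕, ∑ j ∈ S.1.erase i, b j) - ⨆ S : {S : 𝓕 // i ∈ S.1}, ∑ j ∈ S.1.1.erase i, b j

lemma threshold_update (i : ι) (b : ι → ℝ) (x : ℝ) :
    threshold 𝓕 i (Function.update b i x) = threshold 𝓕 i b := by
  simp only [threshold, sum_erase_update]

lemma vcgLazy_isFeasible (h𝓕 : IsLowerSet 𝓕) (hA : IsEfficientRule 𝓕 A) (r : ι → ℝ) :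
    (vcgLazy 𝓕 A r).IsFeasible 𝓕 :=
  fun b => h𝓕 (Finset.filter_subset _ _) (hA b).1

variable [Fintype ι]

lemma measurable_threshold (i : ι) : Measurable (threshold 𝓕 i) := by
  refine (Measurable.iSup fun S => ?_).sub (Measurable.iSup fun S => ?_) <;> fun_prop

lemma threshold_nonneg {i : ι} {b : ι → ℝ} (h : ∃ S ∈ 𝓕, i ∈ S) : 0 ≤ threshold 𝓕 i b := by
  obtain ⟨S, hS, hi⟩ := h
  have : Nonempty {S : 𝓕 // i ∈ S.1} := ⟨⟨⟨S, hS⟩, hi⟩⟩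
  exact sub_nonneg.2 (ciSup_le fun S => le_ciSup (f := fun S : 𝓕 => ∑ j ∈ S.1.erase i, b j)
    (Set.finite_range _).bddAbove S.1)

/-- Among the feasible sets containing `i`, the total bid and the total bid of the others differ by
the constant `b i`, so `A b` maximizes both. -/
lemma IsEfficientRule.vcgPayment_eq (hA : IsEfficientRule 𝓕 A) {i : ι} {b : ι → ℝ}
    (hi : i ∈ A b) : vcgPayment 𝓕 A b i = threshold 𝓕 i b := by
  have : Nonempty {S : 𝓕 // i ∈ S.1} := ⟨⟨⟨A b, (hA b).1⟩, hi⟩⟩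
  rw [vcgPayment, threshold]
  congr 1
  refine le_antisymm (le_ciSup (f := fun S : {S : 𝓕 // i ∈ S.1} => ∑ j ∈ S.1.1.erase i, b j)
    (Set.finite_range _).bddAbove ⟨⟨A b, (hA b).1⟩, hi⟩) (ciSup_le fun S => ?_)
  have h := (hA b).2 S.1.1 S.1.2
  rw [← Finset.add_sum_erase _ _ hi, ← Finset.add_sum_erase _ _ S.2] at h
  exact le_of_add_le_add_left h

lemma IsEfficientRule.threshold_le (h𝓕 : IsLowerSet 𝓕) (hA : IsEfficientRule 𝓕 A) {i : ι} {b : ι → ℝ}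
    (hi : i ∈ A b) : threshold 𝓕 i b ≤ b i := by
  have : Nonempty 𝓕 := ⟨⟨A b, (hA b).1⟩⟩
  rw [← hA.vcgPayment_eq hi, vcgPayment, sub_le_iff_le_add, Finset.add_sum_erase _ _ hi]
  refine ciSup_le fun S => ?_
  exact (hA b).2 _ (h𝓕 (Finset.erase_subset i S.1) S.2)

lemma IsEfficientRule.le_threshold (hA : IsEfficientRule 𝓕 A) {i : ι} {b : ι → ℝ}
    (hF : ∃ S ∈ 𝓕, i ∈ S) (hi : i ∉ A b) : b i ≤ threshold 𝓕 i b := by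
  obtain ⟨S, hS, hiS⟩ := hF
  have : Nonempty {S : 𝓕 // i ∈ S.1} := ⟨⟨⟨S, hS⟩, hiS⟩⟩
  have h1 : ∑ j ∈ A b, b j ≤ ⨆ S : 𝓕, ∑ j ∈ S.1.erase i, b j := by
    have := le_ciSup (f := fun S : 𝓕 => ∑ j ∈ S.1.erase i, b j)
      (Set.finite_range _).bddAbove ⟨A b, (hA b).1⟩
    rwa [Finset.erase_eq_of_notMem hi] at this
  rw [threshold, le_sub_comm]
  refine ciSup_le fun S => ?_
  have h := (hA b).2 S.1.1 S.1.2
  rw [← Finset.add_sum_erase _ _ S.2] at h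
  linarith

lemma vcgLazy_utility (hA : IsEfficientRule 𝓕 A) (r : ι → ℝ) (i : ι) (x : ℝ) (b : ι → ℝ) :
    (vcgLazy 𝓕 A r).utility i x b =
      if i ∈ A b ∧ r i ≤ b i then x - max (r i) (threshold 𝓕 i b) else 0 := by
  by_cases h : i ∈ A b ∧ r i ≤ b i
  · simp [Mechanism.utility, vcgLazy, h, hA.vcgPayment_eq h.1]
  · simp [Mechanism.utility, vcgLazy, h]

lemma vcgLazy_isTruthful (h𝓕 : IsLowerSet 𝓕) (hA : IsEfficientRule 𝓕 A) (r : ι → ℝ) :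
    (vcgLazy 𝓕 A r).IsTruthful := by
  intro i x b
  rw [vcgLazy_utility hA, vcgLazy_utility hA, threshold_update, Function.update_self]
  have h1 : i ∈ A (Function.update b i x) → threshold 𝓕 i b ≤ x := fun h => by
    simpa [threshold_update] using hA.threshold_le h𝓕 h
  have h2 : i ∈ A b → i ∉ A (Function.update b i x) → x ≤ threshold 𝓕 i b := fun hb h => by
    simpa [threshold_update] using hA.le_threshold ⟨A b, (hA b).1, hb⟩ h
  split_ifs with h3 h4 h4
  · exact le_rfl
  -- The misreport wins but the truth loses: then `x` is at most the reserve or the threshold, hence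
  -- at most the price.
  · rw [sub_nonpos, le_max_iff]
    by_cases h5 : i ∈ A (Function.update b i x)
    · exact Or.inl (le_of_not_ge fun h => h4 ⟨h5, h⟩)
    · exact Or.inr (h2 h3.1 h5)
  · exact sub_nonneg.2 (max_le h4.2 (h1 h4.1))
  · exact le_rfl

end Threshold

/-! ### Integrating out one agent's value. -/

section Expectation

variable {ι : Type*} [Fintype ι] [DecidableEq ι] {μ : ι → Measure ℝ}
  [∀ i, IsProbabilityMeasure (μ i)]

/-- An atomless coordinate almost surely differs from a function of the other coordinates. -/
lemma ae_ne_of_update_eq (i : ι) [NullSingletonClass (μ i)] {τ : (ι → ℝ) → ℝ} (hτ : Measurable τ)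
    (h : ∀ v x, τ (Function.update v i x) = τ v) : ∀ᵐ v ∂Measure.pi μ, v i ≠ τ v := by
  have hs : MeasurableSet {v : ι → ℝ | v i = τ v} := measurableSet_eq_fun (by fun_prop) hτ
  rw [ae_iff]
  simp only [ne_eq, not_not]
  rw [← lintegral_indicator_one hs, ← nonpos_iff_eq_zero]
  calc _ ≤ ∫⁻ _, 0 ∂Measure.pi μ := by
        refine lintegral_le_of_lmarginal_le {i} (measurable_one.indicator hs) measurable_const ?_
        intro v
        rw [lmarginal_singleton, lmarginal_singleton]
        have : ∀ x, {v : ι → ℝ | v i = τ v}.indicator (1 : (ι → ℝ) → ℝ≥0∞)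
            (Function.update v i x) = ({τ v} : Set ℝ).indicator 1 x := fun x => by
          simp [Set.indicator_apply, h]
        simp_rw [this]
        rw [lintegral_indicator_one (measurableSet_singleton _)]
        simp
    _ = 0 := by simp

/-- Conditioning on the other coordinates. -/
lemma lintegral_welfare_le (i : ι) {C : ℝ≥0∞} {ρ : ℝ}
    (hle : ∀ t, ∫⁻ x in Set.Ioi t, ENNReal.ofReal x ∂μ i ≤
      C * ENNReal.ofReal (max ρ t) * μ i (Set.Ioi (max ρ t)))
    {τ : (ι → ℝ) → ℝ} (hτ : Measurable τ) (h : ∀ v x, τ (Function.update v i x) = τ v) :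
    ∫⁻ v, (if τ v < v i then ENNReal.ofReal (v i) else 0) ∂Measure.pi μ ≤
      ∫⁻ v, C * (if max ρ (τ v) < v i then ENNReal.ofReal (max ρ (τ v)) else 0) ∂Measure.pi μ := by
  refine lintegral_le_of_lmarginal_le {i} ?_ ?_ ?_
  · exact Measurable.ite (measurableSet_lt hτ (by fun_prop)) (by fun_prop) measurable_const
  · exact (Measurable.ite (measurableSet_lt (by fun_prop) (by fun_prop)) (by fun_prop)
      measurable_const).const_mul C
  intro v
  rw [lmarginal_singleton, lmarginal_singleton]
  simp only [h, Function.update_self]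
  have e1 : ∀ (s : ℝ) (g : ℝ → ℝ≥0∞), (fun x => if s < x then g x else 0) =
    (Set.Ioi s).indicator g := fun s g => by ext x; simp [Set.indicator_apply]
  rw [lintegral_const_mul _ (Measurable.ite (measurableSet_lt (by fun_prop) (by fun_prop))
    (by fun_prop) measurable_const), e1 _ fun x => ENNReal.ofReal x,
    e1 _ fun _ => ENNReal.ofReal (max ρ (τ v)), lintegral_indicator measurableSet_Ioi,
    lintegral_indicator measurableSet_Ioi, setLIntegral_const, ← mul_assoc]
  exact hle _

end Expectation

/-! ### Comparing welfare and payment for each agent. -/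

section Revenue

variable {ι : Type*} [Fintype ι] [DecidableEq ι] {𝓕 : Set (Finset ι)} {A : (ι → ℝ) → Finset ι}
  {μ : ι → Measure ℝ} [∀ i, IsProbabilityMeasure (μ i)]

/-- The contribution of an agent to the welfare is at most `c` times her expected payment. -/
lemma agent_revenue_bound (h𝓕 : IsLowerSet 𝓕) (hA : IsEfficientRule 𝓕 A) {c : ℝ} (hc : 0 < c)
    {r : ι → ℝ} (i : ι) [NullSingletonClass (μ i)] (hr : 0 ≤ r i) (hint : Integrable id (μ i))
    (hle : ∀ t, ∫⁻ x in Set.Ioi t, ENNReal.ofReal x ∂μ i ≤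
      ENNReal.ofReal c * ENNReal.ofReal (max (r i) t) * μ i (Set.Ioi (max (r i) t))) :
    Integrable (fun v => if i ∈ A v then v i else 0) (Measure.pi μ) ∧
      Integrable (fun v => (vcgLazy 𝓕 A r).pay v i) (Measure.pi μ) ∧
      ∫ v, (if i ∈ A v then v i else 0) ∂Measure.pi μ ≤
        c * ∫ v, (vcgLazy 𝓕 A r).pay v i ∂Measure.pi μ := by
  -- If no feasible set contains `i`, the supremum subtracted in `threshold` is an empty one with
  -- default value `0`; such an agent never wins, and both integrands vanish.
  by_cases hF : ∃ S ∈ 𝓕, i ∈ S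
  swap
  · have h : ∀ v, i ∉ A v := fun v hi => hF ⟨A v, (hA v).1, hi⟩
    simp [vcgLazy, h]
  set τ := threshold 𝓕 i
  have hτ : Measurable τ := measurable_threshold i
  have hτ0 : ∀ v, 0 ≤ τ v := fun v => threshold_nonneg hF
  -- Tie-breaking in `A` need not be measurable; `w` and `p` are measurable functions agreeing with
  -- the welfare share and the payment off the null set of ties.
  set w : (ι → ℝ) → ℝ := fun v => if τ v < v i then v i else 0
  set p : (ι → ℝ) → ℝ := fun v => if max (r i) (τ v) < v i then max (r i) (τ v) else 0
  have hne := ae_ne_of_update_eq (μ := μ) i hτ fun v x => threshold_update i v x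
  have hnr := ae_ne_of_update_eq (μ := μ) i (τ := fun _ => r i) measurable_const fun _ _ => rfl
  have hw : (fun v => if i ∈ A v then v i else 0) =ᵐ[Measure.pi μ] w := by
    filter_upwards [hne] with v hv
    refine if_congr ⟨fun h => (hA.threshold_le h𝓕 h).lt_of_ne hv.symm, fun h => ?_⟩ rfl rfl
    by_contra hn
    exact (hA.le_threshold hF hn).not_gt h
  have hp : (fun v => (vcgLazy 𝓕 A r).pay v i) =ᵐ[Measure.pi μ] p := by
    filter_upwards [hne, hnr] with v hv hv'
    by_cases h : i ∈ A v ∧ r i ≤ v i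
    · have h' : max (r i) (τ v) < v i :=
        max_lt (h.2.lt_of_ne hv'.symm) ((hA.threshold_le h𝓕 h.1).lt_of_ne hv.symm)
      simp only [vcgLazy, p, if_pos h, if_pos h', hA.vcgPayment_eq h.1, τ]
    · have h' : ¬ max (r i) (τ v) < v i := fun h' => by
        rw [max_lt_iff] at h'
        refine h ⟨?_, h'.1.le⟩
        by_contra hn
        exact (hA.le_threshold hF hn).not_gt h'.2
      simp only [vcgLazy, p, if_neg h, if_neg h']
  have hwm : Measurable w :=
    Measurable.ite (measurableSet_lt hτ (by fun_prop)) (by fun_prop) measurable_const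
  have hpm : Measurable p :=
    Measurable.ite (measurableSet_lt (by fun_prop) (by fun_prop)) (by fun_prop) measurable_const
  have hw0 : ∀ v, 0 ≤ w v := fun v => by
    simp only [w]; split_ifs with h
    · exact (hτ0 v).trans h.le
    · exact le_rfl
  have hp0 : ∀ v, 0 ≤ p v := fun v => by
    simp only [p]; split_ifs with h
    · exact le_max_of_le_left hr
    · exact le_rfl
  have hvi : Integrable (fun v : ι → ℝ => v i) (Measure.pi μ) :=
    (measurePreserving_eval μ i).integrable_comp_of_integrable hint
  have hwi : Integrable w (Measure.pi μ) := hvi.mono hwm.aestronglyMeasurable <|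
    Filter.Eventually.of_forall fun v => by
      simp only [w]; split_ifs <;> simp
  have hpi : Integrable p (Measure.pi μ) := hvi.mono hpm.aestronglyMeasurable <|
    Filter.Eventually.of_forall fun v => by
      rw [Real.norm_of_nonneg (hp0 v)]
      simp only [p]; split_ifs with h
      · exact h.le.trans (le_abs_self _)
      · exact norm_nonneg _
  refine ⟨hwi.congr hw.symm, hpi.congr hp.symm, ?_⟩
  rw [integral_congr_ae hw, integral_congr_ae hp, ← integral_const_mul,
    ← ENNReal.ofReal_le_ofReal_iff (integral_nonneg fun v => mul_nonneg hc.le (hp0 v)),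
    ofReal_integral_eq_lintegral_ofReal hwi (Filter.Eventually.of_forall hw0),
    ofReal_integral_eq_lintegral_ofReal (hpi.const_mul c)
      (Filter.Eventually.of_forall fun v => mul_nonneg hc.le (hp0 v))]
  have key := lintegral_welfare_le (μ := μ) i hle hτ fun v x => threshold_update i v x
  simpa only [w, p, ENNReal.ofReal_mul hc.le, apply_ite ENNReal.ofReal, ENNReal.ofReal_zero]
    using key

end Revenue

end LazyVCG

theorem mainTheorem7 {ι : Type*} [Fintype ι] [DecidableEq ι]
    (𝓕 : Set (Finset ι)) (h𝓕 : IsLowerSet 𝓕)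
    (μ : ι → Measure ℝ) [∀ i, IsProbabilityMeasure (μ i)] (f : ι → ℝ → ℝ≥0)
    (hf : ∀ i, LazyVCG.IsValueDensity (μ i) (f i))
    (c : ℝ) (hc : 0 < c)
    (hbdd : ∀ i, LazyVCG.IsCBounded c (μ i))
    (hreg : ∀ i, LazyVCG.IsHyperRegular (μ i) (f i))
    (A : (ι → ℝ) → Finset ι) (hA : LazyVCG.IsEfficientRule 𝓕 A)
    (M : LazyVCG.Mechanism ι)
    (hM : M = LazyVCG.vcgLazy 𝓕 A (fun i => LazyVCG.reservePrice (μ i) (f i))) :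
    M.IsFeasible 𝓕 ∧ M.IsTruthful ∧
      Integrable (LazyVCG.maxWelfare 𝓕) (Measure.pi μ) ∧
      Integrable M.revenue (Measure.pi μ) ∧
      1 / c * ∫ v, LazyVCG.maxWelfare 𝓕 v ∂(Measure.pi μ) ≤
        ∫ v, M.revenue v ∂(Measure.pi μ) := by
  have hagent := fun i =>
    have := (hf i).nullSingletonClass
    LazyVCG.agent_revenue_bound (μ := μ) (r := fun i => LazyVCG.reservePrice (μ i) (f i)) h𝓕 hA hc i
      LazyVCG.reservePrice_nonneg ((hbdd i).integrable_id (hf i) (hreg i).1)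
      ((hreg i).lintegral_Ioi_le (hf i) ((hreg i).1.nonnegVirtual_nonempty (hf i) (hbdd i))
        (hbdd i))
  rw [← hM] at hagent
  have hW : LazyVCG.maxWelfare 𝓕 = fun v => ∑ i, if i ∈ A v then v i else 0 :=
    funext fun v => by simp [hA.maxWelfare_eq v]
  have hR : M.revenue = fun v => ∑ i, M.pay v i := rfl
  refine ⟨hM ▸ LazyVCG.vcgLazy_isFeasible h𝓕 hA _, hM ▸ LazyVCG.vcgLazy_isTruthful h𝓕 hA _,
    hW ▸ integrable_finsetSum _ fun i _ => (hagent i).1,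
    hR ▸ integrable_finsetSum _ fun i _ => (hagent i).2.1, ?_⟩
  rw [hW, hR, integral_finsetSum _ fun i _ => (hagent i).1,
    integral_finsetSum _ fun i _ => (hagent i).2.1, one_div, inv_mul_le_iff₀ hc, Finset.mul_sum]
  exact Finset.sum_le_sum fun i _ => (hagent i).2.2
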